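/- Write $\mathbb N=\{1<2<\cdots\}$ and $\mathbb N^\vee=\{\cdots<2^\vee<1^\vee\}$, and let $t$ be an indeterminate. Let $\mathscr U(t)$ be the unital associative $\mathbb Q[t,t^{-1}]$-algebra generated by $u_i$ and $u_{i^\vee}$ ($i\in\mathbb N$) subject to the following relations, where $i,j,k\in\mathbb N$: $$u_iu_ju_k=u_iu_ku_j,\qquad u_{k^\vee}u_{j^\vee}u_{i^\vee}=u_{j^\vee}u_{k^\vee}u_{i^\vee}\qquad (j\le i<k),$$ $$u_ju_ku_i=u_ku_ju_i,\qquad u_{i^\vee}u_{k^\vee}u_{j^\vee}=u_{i^\vee}u_{j^\vee}u_{k^\vee}\qquad (j<i\le k),$$ $$u_{i+1}u_{(i+1)^\vee}=u_{i^\vee}u_i\quad(i\ge 1),\qquad u_1u_{1^\vee}=t,\qquad u_iu_{j^\vee}=u_{j^\vee}u_i\quad(i\ne j).$$ For a finite word $w=w_1\cdots w_r$ with letters in $\mathbb N\cup\mathbb N^\vee$ put $u_w=u_{w_1}\cdots u_{w_r}$ (and $u_w=1$ if $r=0$). For partitions $\mu,\nu$, let $\mathcal B_{\mu,\nu}$ be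 the set of pairs $(S,T)$ such that: $S$ is a semistandard tableau of shape $\mu$ with entries in $\mathbb N$ (rows weakly increasing, columns strictly increasing); $T$ is a semistandard tableau with entries in $\mathbb N^\vee$ whose shape is the diagram of $\nu$ rotated by $180^\circ$; and for every $k\ge 1$ the number of entries $\le k$ in the leftmost column of $S$ plus the number of entries $\ge k^\vee$ in the rightmost column of $T$ is at most $k$. The column word of a tableau is obtained by reading its columns from right to left, and each column from top to bottom. Let $u_S$ and $u_T$ be the monomials of the column words of $S$ and $T$, and put $u_{(S,T)}=u_Su_T$. Proposition. For every word $w=w_1\cdots w_r$ with letters in $\mathbb N\cup\mathbb N^\vee$ there exist partitions $\mu,\nu$ and $(S,T)\in\mathcal B_{\mu,\nu}$ such that $r-|\mu|-|\nu|$ is a nonnegative even integer and $$u_w=t^{\epsilon}\,u_{(S,T)},\qquad \epsilon=\frac{r-|\mu|-|\nu|}{2}.$$ -/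

import Mathlib

namespace RationalPlactic

/-- The alphabet `ℕ ∪ ℕ^∨`, where `ℕ = {1 < 2 < ⋯}`: the letter `pos i` is `i`, and the letter
`dual i` is `i^∨`. Finite words over it are lists of letters. -/
inductive Letter where
  | pos (i : ℕ+) : Letter
  | dual (i : ℕ+) : Letter

/-- The ground ring `ℚ[t, t⁻¹]`. -/
abbrev Ground : Type := LaurentPolynomial ℚ

/-- The generator of the free algebra attached to `i ∈ ℕ`. -/
noncomputable def gen (i : ℕ+) : FreeAlgebra Ground Letter :=
  FreeAlgebra.ι Ground (Letter.pos i)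

/-- The generator of the free algebra attached to `i^∨ ∈ ℕ^∨`. -/
noncomputable def genDual (i : ℕ+) : FreeAlgebra Ground Letter :=
  FreeAlgebra.ι Ground (Letter.dual i)

/-- The defining relations of the plactic algebra: the two Knuth relations (for words that read
the columns of a tableau from right to left, each from top to bottom), their images under the
word-reversing duality `i ↦ i^∨`, and the relations between the two kinds of generators. -/
inductive PlacticRel : FreeAlgebra Ground Letter → FreeAlgebra Ground Letter → Prop
  | knuth₁ (i j k : ℕ+) (hji : j ≤ i) (hik : i < k) :
      PlacticRel (gen i * gen j * gen k) (gen i * gen k * gen j)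
  | knuth₂ (i j k : ℕ+) (hji : j < i) (hik : i ≤ k) :
      PlacticRel (gen j * gen k * gen i) (gen k * gen j * gen i)
  | dualKnuth₁ (i j k : ℕ+) (hji : j ≤ i) (hik : i < k) :
      PlacticRel (genDual k * genDual j * genDual i) (genDual j * genDual k * genDual i)
  | dualKnuth₂ (i j k : ℕ+) (hji : j < i) (hik : i ≤ k) :
      PlacticRel (genDual i * genDual k * genDual j) (genDual i * genDual j * genDual k)
  | shift (i : ℕ+) :
      PlacticRel (gen (i + 1) * genDual (i + 1)) (genDual i * gen i)
  | contract :
      PlacticRel (gen 1 * genDual 1)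
        (algebraMap Ground (FreeAlgebra Ground Letter) (LaurentPolynomial.T 1))
  | comm (i j : ℕ+) (hij : i ≠ j) :
      PlacticRel (gen i * genDual j) (genDual j * gen i)

/-- The plactic algebra `𝒰(t)`: the unital associative `ℚ[t, t⁻¹]`-algebra generated by the `u_i`
and `u_{i^∨}` subject to the relations `PlacticRel`. -/
abbrev PlacticAlgebra : Type := RingQuot PlacticRel

/-- The generators `u_a` of the plactic algebra, for a letter `a`. -/
noncomputable def u (a : Letter) : PlacticAlgebra :=
  RingQuot.mkAlgHom Ground PlacticRel (FreeAlgebra.ι Ground a)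

/-- The word monomial `u_w = u_{w_1} ⋯ u_{w_r}`. -/
noncomputable def uWord (w : List Letter) : PlacticAlgebra :=
  (w.map u).prod

/-- The entry of a semistandard tableau as an element of `{1 < 2 < ⋯}`. Mathlib's semistandard
tableaux have entries in `{0 < 1 < ⋯}`, with rows and columns numbered from `0`; we relabel the
entries by the order isomorphism `n ↦ n + 1`, so that `SemistandardYoungTableau μ` is the set of
all semistandard tableaux of shape `μ` with entries in `{1 < 2 < ⋯}`. -/
def entry {μ : YoungDiagram} (S : SemistandardYoungTableau μ) (i j : ℕ) : ℕ+ :=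
  Nat.succPNat (S i j)

/-- The column word of `S`: columns from right to left, each column from top to bottom. -/
def colWord {μ : YoungDiagram} (S : SemistandardYoungTableau μ) : List Letter :=
  (List.range (μ.rowLen 0)).reverse.flatMap fun j =>
    (List.range (μ.colLen j)).map fun i => Letter.pos (entry S i j)

/-- A tableau `T` of the rotated shape `ν^∨` with entries in `ℕ^∨ = {⋯ < 2^∨ < 1^∨}` is recorded
by its dual `T^∨`, the semistandard tableau of shape `ν` obtained by rotating `T` by 180 degrees
and replacing each entry `a^∨` by `a`; this is a bijection. The columns of `T` from right to left
are the columns of `T^∨` from left to right, and reading a column of `T` from top to bottom is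
reading the corresponding column of `T^∨` from bottom to top. So this is the column word of `T`,
in terms of `Q = T^∨`. -/
def dualColWord {ν : YoungDiagram} (Q : SemistandardYoungTableau ν) : List Letter :=
  (List.range (ν.rowLen 0)).flatMap fun j =>
    (List.range (ν.colLen j)).reverse.map fun i => Letter.dual (entry Q i j)

/-- The set `B_{μ,ν}` of rational semistandard tableaux `(S, T)`. The second tableau `T` has the
rotated shape `ν^∨` and entries in `ℕ^∨` and is recorded by `dualRight = T^∨`. The condition bounds
the number of entries `≤ k` in the leftmost column of `S` plus the number of entries `≥ k^∨` in the
rightmost column of `T` (that is, of entries `≤ k` in the leftmost column of `T^∨`). -/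
structure RationalTableau (μ ν : YoungDiagram) where
  left : SemistandardYoungTableau μ
  dualRight : SemistandardYoungTableau ν
  bound : ∀ k : ℕ+,
    ((Finset.range (μ.colLen 0)).filter fun i => entry left i 0 ≤ k).card +
      ((Finset.range (ν.colLen 0)).filter fun i => entry dualRight i 0 ≤ k).card ≤ (k : ℕ)

/-- The monomial `u_{(S,T)} = u_S u_T`, where `u_S` and `u_T` are the monomials of the column
words of `S` and `T`. -/
noncomputable def uTableau {μ ν : YoungDiagram} (P : RationalTableau μ ν) : PlacticAlgebra :=
  uWord (colWord P.left) * uWord (dualColWord P.dualRight)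

end RationalPlactic

/-!
Pushing the letters `i^∨` to the right turns a word into a word in `ℕ` followed by a word in `ℕ^∨`,
and column insertion turns these into tableaux `S` and `T`. Let `A` be the leftmost column of `S`
and `B^∨` the rightmost column of `T`, which are adjacent in `u_S u_T`, and suppose that together
they have more than `k` letters `≤ k` resp. `≥ k^∨`. Going down from above all letters, the relation
`u_{n+1} u_{(n+1)^∨} = u_{n^∨} u_n` regroups a power of `u_{n+1} u_{(n+1)^∨}`, together with the
letters `n` of `A` and `n^∨` of `B^∨`, into a power of `u_n u_{n^∨}`, with at most one letter left
over on either side. The number of pairs plus the number of letters below `n` thus drops by at most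
one in each step. As it exceeds `k` at `n = k + 1`, a pair `u_1 u_{1^∨} = t` is present at `n = 1`,
and `t` splits off. Since all relations are homogeneous for `deg t = 2`, the remaining word is
shorter by two letters.
-/

namespace RationalPlactic

section Plactic

variable {α M : Type*}

/-- The Knuth relations of the plactic monoid, for a family `f` of elements of a monoid indexed by
an ordered alphabet. The convention is the one for words that read the columns of a tableau from
right to left, each from top to bottom. -/
structure IsPlactic [Preorder α] [Monoid M] (f : α → M) : Prop where
  knuth₁ : ∀ i j k, j ≤ i → i < k → f i * f j * f k = f i * f k * f j
  knuth₂ : ∀ i j k, j < i → i ≤ k → f j * f k * f i = f k * f j * f i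

section Preorder

variable [Preorder α]

/-- The column `D` may stand to the right of the column `C` in a semistandard tableau: `D` is not
longer than `C`, and its entries are at least the entries of `C` in the same rows. -/
inductive Dominates : List α → List α → Prop
  | nil (C : List α) : Dominates C []
  | cons {c d : α} {C D : List α} : c ≤ d → Dominates C D → Dominates (c :: C) (d :: D)

namespace Dominates

theorem refl : ∀ C : List α, Dominates C C
  | [] => nil []
  | _ :: C => cons le_rfl (refl C)

theorem trans {C D E : List α} (hCD : Dominates C D) (hDE : Dominates D E) : Dominates C E := by
  induction hDE generalizing C with
  | nil => exact nil C
  | cons hde _ ih =>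
    cases hCD with
    | cons hcd hCD => exact cons (hcd.trans hde) (ih hCD)

instance : IsTrans (List α) Dominates := ⟨fun _ _ _ => trans⟩

theorem length_le {C D : List α} (h : Dominates C D) : D.length ≤ C.length := by
  induction h with
  | nil => simp
  | cons _ _ ih => simpa using ih

theorem getD_le {C D : List α} (h : Dominates C D) (a : α) {i : ℕ} (hi : i < D.length) :
    C.getD i a ≤ D.getD i a := by
  induction h generalizing i with
  | nil => simp at hi
  | cons hcd _ ih =>
    cases i with
    | zero => simpa using hcd
    | succ i => simpa using ih (by simpa using hi)

end Dominates

/-- A list of columns which, from left to right, are the columns of a semistandard tableau. -/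
structure IsColumnList (Cs : List (List α)) : Prop where
  ne_nil : ∀ C ∈ Cs, C ≠ []
  pairwise_lt : ∀ C ∈ Cs, C.Pairwise (· < ·)
  isChain : Cs.IsChain Dominates

namespace IsColumnList

theorem nil : IsColumnList ([] : List (List α)) := ⟨by simp, by simp, by simp⟩

theorem cons_iff {C : List α} {Cs : List (List α)} :
    IsColumnList (C :: Cs) ↔
      C ≠ [] ∧ C.Pairwise (· < ·) ∧ Dominates C (Cs.headD []) ∧ IsColumnList Cs := by
  have isChain_iff : (C :: Cs).IsChain Dominates ↔
      Dominates C (Cs.headD []) ∧ Cs.IsChain Dominates := by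
    cases Cs <;> simp [Dominates.nil]
  constructor
  · rintro ⟨hne, hlt, hchain⟩
    rw [List.forall_mem_cons] at hne hlt
    exact ⟨hne.1, hlt.1, (isChain_iff.1 hchain).1, hne.2, hlt.2, (isChain_iff.1 hchain).2⟩
  · rintro ⟨hne, hlt, hdom, hCs⟩
    exact ⟨List.forall_mem_cons.2 ⟨hne, hCs.ne_nil⟩,
      List.forall_mem_cons.2 ⟨hlt, hCs.pairwise_lt⟩, isChain_iff.2 ⟨hdom, hCs.isChain⟩⟩

theorem pairwise_lt_getD {Cs : List (List α)} (h : IsColumnList Cs) (j : ℕ) :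
    (Cs.getD j []).Pairwise (· < ·) := by
  by_cases hj : j < Cs.length
  · rw [List.getD_eq_getElem _ _ hj]
    exact h.pairwise_lt _ (List.getElem_mem hj)
  · rw [List.getD_eq_default _ _ (not_lt.1 hj)]
    exact .nil

theorem pairwise_lt_headD {Cs : List (List α)} (h : IsColumnList Cs) :
    (Cs.headD []).Pairwise (· < ·) :=
  List.headD_eq_getD (l := Cs) ▸ h.pairwise_lt_getD 0

theorem dominates_getD {Cs : List (List α)} (h : IsColumnList Cs) {i j : ℕ} (hij : i ≤ j) :
    Dominates (Cs.getD i []) (Cs.getD j []) := by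
  rcases hij.eq_or_lt with rfl | hij
  · exact .refl _
  by_cases hj : j < Cs.length
  · rw [List.getD_eq_getElem _ _ hj, List.getD_eq_getElem _ _ (hij.trans hj)]
    exact List.pairwise_iff_getElem.1 h.isChain.pairwise i j _ _ hij
  · rw [List.getD_eq_default _ _ (not_lt.1 hj)]
    exact .nil _

end IsColumnList

end Preorder

section LinearOrder

variable [LinearOrder α]

/-- Insert `x` into a strictly increasing column: `x` takes the place of the first entry `≥ x`, or
is appended at the bottom if there is no such entry. -/
def bump (x : α) : List α → List α
  | [] => [x]
  | c :: C => if c < x then c :: bump x C else x :: C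

theorem bump_cons_of_lt {c x : α} (h : c < x) (C : List α) : bump x (c :: C) = c :: bump x C :=
  if_pos h

theorem bump_cons_of_le {c x : α} (h : x ≤ c) (C : List α) : bump x (c :: C) = x :: C :=
  if_neg h.not_gt

theorem bump_ne_nil (x : α) (C : List α) : bump x C ≠ [] := by
  cases C with
  | nil => simp [bump]
  | cons c C => rw [bump]; split_ifs <;> simp

theorem bump_eq_append {x : α} {C : List α} (h : ∀ c ∈ C, c < x) : bump x C = C ++ [x] := by
  induction C with
  | nil => rfl
  | cons c C ih =>
    rw [List.forall_mem_cons] at h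
    rw [bump_cons_of_lt h.1, ih h.2, List.cons_append]

theorem eq_or_mem_of_mem_bump {a x : α} {C : List α} (h : a ∈ bump x C) : a = x ∨ a ∈ C := by
  induction C with
  | nil => exact Or.inl (List.mem_singleton.1 h)
  | cons c C ih => grind [bump]

theorem pairwise_lt_bump (x : α) {C : List α} (hC : C.Pairwise (· < ·)) :
    (bump x C).Pairwise (· < ·) := by
  induction C with
  | nil => exact List.pairwise_singleton _ _
  | cons c C ih =>
    obtain ⟨hc, hC⟩ := List.pairwise_cons.1 hC
    rcases lt_or_ge c x with hcx | hxc
    · rw [bump_cons_of_lt hcx, List.pairwise_cons]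
      refine ⟨fun a ha => ?_, ih hC⟩
      rcases eq_or_mem_of_mem_bump ha with rfl | ha
      exacts [hcx, hc a ha]
    · rw [bump_cons_of_le hxc, List.pairwise_cons]
      exact ⟨fun a ha => hxc.trans_lt (hc a ha), hC⟩

theorem Dominates.bump_left (x : α) {C D : List α} (h : Dominates C D) :
    Dominates (bump x C) D := by
  induction h with
  | nil => exact .nil _
  | @cons c d C D hcd hCD ih =>
    rcases lt_or_ge c x with hcx | hxc
    · rw [bump_cons_of_lt hcx]
      exact cons hcd ih
    · rw [bump_cons_of_le hxc]
      exact cons (hxc.trans hcd) hCD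

theorem Dominates.bump {x y : α} {C D : List α} (h : Dominates C D)
    (hy : C.find? (x ≤ ·) = some y) : Dominates (bump x C) (bump y D) := by
  have hxy : x ≤ y := by simpa using List.find?_some hy
  induction h with
  | nil C =>
    cases C with
    | nil => simp at hy
    | cons c C =>
      rcases lt_or_ge c x with hcx | hxc
      · rw [bump_cons_of_lt hcx]
        exact cons (hcx.le.trans hxy) (.nil _)
      · rw [bump_cons_of_le hxc]
        exact cons hxy (.nil _)
  | @cons c d C D hcd hCD ih =>
    rcases lt_or_ge c x with hcx | hxc
    · rw [List.find?_cons_of_neg (by simpa using hcx)] at hy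
      rw [bump_cons_of_lt hcx]
      rcases lt_or_ge d y with hdy | hyd
      · rw [bump_cons_of_lt hdy]
        exact cons hcd (ih hy)
      · rw [bump_cons_of_le hyd]
        exact cons (hcx.le.trans hxy) (hCD.bump_left x)
    · rw [List.find?_cons_of_pos (by simpa using hxc), Option.some_inj] at hy
      subst hy
      rw [bump_cons_of_le hxc, bump_cons_of_le hcd]
      exact cons hxc hCD

/-- Column insertion of a letter into a tableau, given by its columns from left to right: the
entry bumped out of a column is inserted into the next column. -/
def columnInsert : List (List α) → α → List (List α)
  | [], x => [[x]]
  | C :: Cs, x => bump x C :: (C.find? (x ≤ ·)).elim Cs (columnInsert Cs)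

theorem headD_columnInsert (Cs : List (List α)) (x : α) :
    (columnInsert Cs x).headD [] = bump x (Cs.headD []) := by
  cases Cs <;> rfl

theorem IsColumnList.columnInsert {Cs : List (List α)} (h : IsColumnList Cs) (x : α) :
    IsColumnList (columnInsert Cs x) := by
  induction Cs generalizing x with
  | nil => exact cons_iff.2 ⟨by simp, List.pairwise_singleton _ _, .nil _, nil⟩
  | cons C Cs ih =>
    obtain ⟨-, hlt, hdom, hCs⟩ := cons_iff.1 h
    refine cons_iff.2 ⟨bump_ne_nil x C, pairwise_lt_bump x hlt, ?_⟩
    cases hfind : C.find? (x ≤ ·) with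
    | none => exact ⟨hdom.bump_left x, hCs⟩
    | some y => exact ⟨headD_columnInsert Cs y ▸ hdom.bump hfind, ih hCs y⟩

/-- The columns of the insertion tableau of a word. -/
def insertionTableau (w : List α) : List (List α) :=
  w.foldl columnInsert []

theorem insertionTableau_append_singleton (w : List α) (x : α) :
    insertionTableau (w ++ [x]) = columnInsert (insertionTableau w) x :=
  List.foldl_concat ..

theorem isColumnList_insertionTableau (w : List α) : IsColumnList (insertionTableau w) := by
  induction w using List.reverseRecOn with
  | nil => exact .nil
  | append_singleton w x ih => exact insertionTableau_append_singleton w x ▸ ih.columnInsert x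

end LinearOrder

/-- The column word of a list of columns: the columns from right to left, each from top to
bottom. -/
def columnWord (Cs : List (List α)) : List α :=
  Cs.reverse.flatten

theorem columnWord_cons (C : List α) (Cs : List (List α)) :
    columnWord (C :: Cs) = columnWord Cs ++ C := by
  simp [columnWord]

theorem columnWord_eq_append_headD (Cs : List (List α)) :
    columnWord Cs = columnWord Cs.tail ++ Cs.headD [] := by
  cases Cs <;> simp [columnWord]

namespace IsPlactic

variable [Monoid M] {f : α → M}

theorem mul_prod_mul_comm [Preorder α] (hf : IsPlactic f) {x y : α} (hxy : x ≤ y) {C : List α}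
    (hC : (y :: C).Pairwise (· < ·)) :
    f y * (C.map f).prod * f x = f y * f x * (C.map f).prod := by
  induction C generalizing y with
  | nil => simp
  | cons c C ih =>
    obtain ⟨hy, hC⟩ := List.pairwise_cons.1 hC
    have hyc : y < c := hy c (by simp)
    calc f y * ((c :: C).map f).prod * f x
        = f y * (f c * (C.map f).prod * f x) := by simp [mul_assoc]
      _ = f y * f c * f x * (C.map f).prod := by rw [ih (hxy.trans hyc.le) hC]; simp [mul_assoc]
      _ = f y * f x * ((c :: C).map f).prod := by
        rw [← hf.knuth₁ y x c hxy hyc]; simp [mul_assoc]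

variable [LinearOrder α]

theorem mul_mul_prod_bump (hf : IsPlactic f) {c x y : α} (hcx : c < x) (hxy : x ≤ y) {C : List α}
    (hC : ∀ a ∈ C, c < a) :
    f c * f y * ((bump x C).map f).prod = f y * f c * ((bump x C).map f).prod := by
  obtain ⟨m, D, hm, hcm, hmx⟩ : ∃ m D, bump x C = m :: D ∧ c < m ∧ m ≤ x := by
    cases C with
    | nil => exact ⟨x, [], rfl, hcx, le_rfl⟩
    | cons a C =>
      rcases lt_or_ge a x with hax | hxa
      · exact ⟨a, _, bump_cons_of_lt hax C, hC a (by simp), hax.le⟩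
      · exact ⟨x, _, bump_cons_of_le hxa C, hcx, le_rfl⟩
  rw [hm, List.map_cons, List.prod_cons, ← mul_assoc, ← mul_assoc,
    hf.knuth₂ m c y hcm (hmx.trans hxy)]

theorem mul_prod_bump (hf : IsPlactic f) {x y : α} {C : List α} (hC : C.Pairwise (· < ·))
    (hy : C.find? (x ≤ ·) = some y) :
    f y * ((bump x C).map f).prod = (C.map f).prod * f x := by
  have hxy : x ≤ y := by simpa using List.find?_some hy
  induction C with
  | nil => simp at hy
  | cons c C ih =>
    rcases lt_or_ge c x with hcx | hxc
    · rw [List.find?_cons_of_neg (by simpa using hcx)] at hy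
      obtain ⟨hc, hC⟩ := List.pairwise_cons.1 hC
      calc f y * ((bump x (c :: C)).map f).prod
          = f y * f c * ((bump x C).map f).prod := by simp [bump_cons_of_lt hcx, mul_assoc]
        _ = f c * (f y * ((bump x C).map f).prod) := by
          rw [← hf.mul_mul_prod_bump hcx hxy hc, mul_assoc]
        _ = ((c :: C).map f).prod * f x := by rw [ih hC hy]; simp [mul_assoc]
    · rw [List.find?_cons_of_pos (by simpa using hxc), Option.some_inj] at hy
      subst hy
      simpa [bump_cons_of_le hxc, mul_assoc] using (hf.mul_prod_mul_comm hxc hC).symm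

theorem prod_columnWord_columnInsert (hf : IsPlactic f) {Cs : List (List α)}
    (hCs : ∀ C ∈ Cs, C.Pairwise (· < ·)) (x : α) :
    ((columnWord (columnInsert Cs x)).map f).prod = ((columnWord Cs).map f).prod * f x := by
  induction Cs generalizing x with
  | nil => simp [columnInsert, columnWord]
  | cons C Cs ih =>
    obtain ⟨hC, hCs⟩ := List.forall_mem_cons.1 hCs
    rw [columnInsert, columnWord_cons, columnWord_cons]
    cases hfind : C.find? (x ≤ ·) with
    | none =>
      have hlt : ∀ c ∈ C, c < x := by simpa using hfind
      simp [bump_eq_append hlt, mul_assoc]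
    | some y =>
      simp only [Option.elim_some, List.map_append, List.prod_append, ih hCs, mul_assoc,
        hf.mul_prod_bump hC hfind]

theorem prod_columnWord_insertionTableau (hf : IsPlactic f) (w : List α) :
    ((columnWord (insertionTableau w)).map f).prod = (w.map f).prod := by
  induction w using List.reverseRecOn with
  | nil => rfl
  | append_singleton w x ih =>
    rw [insertionTableau_append_singleton,
      hf.prod_columnWord_columnInsert (isColumnList_insertionTableau w).pairwise_lt, ih]
    simp

end IsPlactic

end Plactic

section Tableau

theorem sum_map_colLen_range (μ : YoungDiagram) :
    ((List.range (μ.rowLen 0)).map μ.colLen).sum = μ.card := by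
  have hmaps : ∀ c ∈ μ.cells, c.2 ∈ Finset.range (μ.rowLen 0) := fun c hc =>
    Finset.mem_range.2 <| YoungDiagram.mem_iff_lt_rowLen.1 <|
      μ.up_left_mem (Nat.zero_le c.1) le_rfl hc
  rw [YoungDiagram.card, Finset.card_eq_sum_card_fiberwise hmaps,
    ← List.toFinset_range, List.sum_toFinset _ List.nodup_range]
  exact congrArg List.sum (List.map_congr_left fun _ _ => μ.colLen_eq_card)

theorem length_colWord {μ : YoungDiagram} (S : SemistandardYoungTableau μ) :
    (colWord S).length = μ.card := by
  simp [colWord, List.length_flatMap, sum_map_colLen_range, List.map_reverse]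

theorem length_dualColWord {ν : YoungDiagram} (Q : SemistandardYoungTableau ν) :
    (dualColWord Q).length = ν.card := by
  simp [dualColWord, List.length_flatMap, sum_map_colLen_range]

theorem map_getD_range {β : Type*} (l : List β) (d : β) :
    (List.range l.length).map (fun i => l.getD i d) = l := by
  apply List.ext_getElem <;> simp +contextual

namespace IsColumnList

section Shape

variable {α : Type*} [Preorder α] {Cs : List (List α)}

/-- The Young diagram whose columns have the lengths of the given columns. -/
def shape (h : IsColumnList Cs) : YoungDiagram :=
  (YoungDiagram.ofRowLens (Cs.map List.length)
    (List.pairwise_map.2 (h.isChain.pairwise.imp Dominates.length_le)).sortedGE).transpose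

theorem mem_shape (h : IsColumnList Cs) {i j : ℕ} :
    (i, j) ∈ h.shape ↔ i < (Cs.getD j []).length := by
  rw [shape, YoungDiagram.mem_transpose, YoungDiagram.mem_ofRowLens]
  by_cases hj : j < Cs.length <;> simp [hj]

theorem colLen_shape (h : IsColumnList Cs) (j : ℕ) :
    h.shape.colLen j = (Cs.getD j []).length :=
  eq_of_forall_lt_iff fun i => by rw [← YoungDiagram.mem_iff_lt_colLen, mem_shape]

theorem rowLen_shape (h : IsColumnList Cs) : h.shape.rowLen 0 = Cs.length := by
  have hpos : ∀ n ∈ Cs.map List.length, 0 < n := by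
    simpa [List.length_pos_iff] using h.ne_nil
  rw [shape, YoungDiagram.rowLen_transpose, ← YoungDiagram.length_rowLens,
    YoungDiagram.rowLens_length_ofRowLens hpos, List.length_map]

end Shape

variable {Cs : List (List ℕ+)}

/-- The semistandard tableau with the given columns. -/
def tableau (h : IsColumnList Cs) : SemistandardYoungTableau h.shape where
  entry i j := ((Cs.getD j []).getD i 1).natPred
  row_weak' hj hm :=
    PNat.natPred_le_natPred.2 ((h.dominates_getD hj.le).getD_le 1 (h.mem_shape.1 hm))
  col_strict' {i₁ i₂ j} hi hm := by
    rw [mem_shape] at hm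
    rw [PNat.natPred_lt_natPred, List.getD_eq_getElem _ _ hm,
      List.getD_eq_getElem _ _ (hi.trans hm)]
    exact List.pairwise_iff_getElem.1 (h.pairwise_lt_getD j) i₁ i₂ _ _ hi
  zeros' hm := by
    rw [mem_shape, not_lt] at hm
    rw [List.getD_eq_default _ _ hm]
    rfl

theorem map_entry_tableau (h : IsColumnList Cs) (j : ℕ) :
    (List.range (h.shape.colLen j)).map (entry h.tableau · j) = Cs.getD j [] := by
  have entry_eq (i : ℕ) : entry h.tableau i j = (Cs.getD j []).getD i 1 :=
    PNat.succPNat_natPred _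
  simp only [entry_eq, colLen_shape, map_getD_range]

theorem colWord_tableau (h : IsColumnList Cs) :
    colWord h.tableau = (columnWord Cs).map Letter.pos := by
  have column_eq (j : ℕ) : (List.range (h.shape.colLen j)).map
      (fun i => Letter.pos (entry h.tableau i j)) = (Cs.getD j []).map Letter.pos := by
    simp only [← h.map_entry_tableau j, List.map_map, Function.comp_def]
  conv_rhs => rw [← map_getD_range Cs []]
  simp only [colWord, columnWord, column_eq, rowLen_shape, List.flatMap_def, List.map_flatten,
    List.map_reverse, List.map_map, Function.comp_def]

theorem dualColWord_tableau (h : IsColumnList Cs) :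
    dualColWord h.tableau = (columnWord Cs).reverse.map Letter.dual := by
  have column_eq (j : ℕ) : (List.range (h.shape.colLen j)).reverse.map
      (fun i => Letter.dual (entry h.tableau i j)) = (Cs.getD j []).reverse.map Letter.dual := by
    simp only [← h.map_entry_tableau j, List.map_reverse, List.map_map, Function.comp_def]
  conv_rhs => rw [← map_getD_range Cs []]
  simp only [dualColWord, columnWord, column_eq, rowLen_shape, List.flatMap_def, List.map_flatten,
    List.reverse_flatten, List.map_reverse, List.reverse_reverse, List.map_map, Function.comp_def]

theorem card_filter_entry_tableau (h : IsColumnList Cs) (k : ℕ+) :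
    ((Finset.range (h.shape.colLen 0)).filter fun i => entry h.tableau i 0 ≤ k).card =
      (Cs.headD []).countP (· ≤ k) := by
  rw [List.headD_eq_getD, ← h.map_entry_tableau 0, List.countP_map,
    ← Nat.count_eq_card_filter_range, Nat.count]
  rfl

end IsColumnList

end Tableau

section RationalPlactic

variable {M : Type*} [Monoid M]

/-- The relations between the generators `u_a` of the plactic algebra and `t`, for a family `f` of
elements of a monoid and an element `t`, which has to be central with respect to `f`. -/
structure IsRationalPlactic (f : Letter → M) (t : M) : Prop where
  isPlactic_pos : IsPlactic (f ∘ Letter.pos)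
  isPlactic_op_dual : IsPlactic (MulOpposite.op ∘ f ∘ Letter.dual)
  shift : ∀ i, f (.pos (i + 1)) * f (.dual (i + 1)) = f (.dual i) * f (.pos i)
  contract : f (.pos 1) * f (.dual 1) = t
  commute : ∀ i j, i ≠ j → Commute (f (.pos i)) (f (.dual j))
  central : ∀ a, Commute t (f a)

namespace IsRationalPlactic

variable {f : Letter → M} {t : M}

theorem commute_dual_prod_pos (h : IsRationalPlactic f t) {n : ℕ+} {A : List ℕ+} (hn : n ∉ A) :
    Commute (f (.dual n)) (A.map (f ∘ Letter.pos)).prod :=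
  Commute.list_prod_right _ _ <| List.forall_mem_map.2 fun a ha =>
    (h.commute a n fun han => hn (han ▸ ha)).symm

theorem commute_pos_prod_dual (h : IsRationalPlactic f t) {n : ℕ+} {B : List ℕ+} (hn : n ∉ B) :
    Commute (f (.pos n)) (B.map (f ∘ Letter.dual)).prod :=
  Commute.list_prod_right _ _ <| List.forall_mem_map.2 fun b hb =>
    h.commute n b fun hnb => hn (hnb ▸ hb)

theorem exists_dual_mul_prod_pos (h : IsRationalPlactic f t) (A : List ℕ+) (j : ℕ+) :
    ∃ (A' : List ℕ+) (j' : ℕ+), f (.dual j) * (A.map (f ∘ Letter.pos)).prod =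
      (A'.map (f ∘ Letter.pos)).prod * f (.dual j') := by
  induction A generalizing j with
  | nil => exact ⟨[], j, by simp⟩
  | cons a A ih =>
    obtain ⟨a', i, hai⟩ : ∃ a' i : ℕ+,
        f (.dual j) * f (.pos a) = f (.pos a') * f (.dual i) := by
      by_cases haj : a = j
      · exact ⟨j + 1, j + 1, by rw [haj, h.shift]⟩
      · exact ⟨a, j, (h.commute a j haj).symm.eq⟩
    obtain ⟨A', j', hA'⟩ := ih i
    refine ⟨a' :: A', j', ?_⟩
    simp only [List.map_cons, List.prod_cons, Function.comp_apply, mul_assoc, ← hA']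
    simp only [← mul_assoc, hai]

theorem exists_prod_eq_prod_pos_mul_prod_dual (h : IsRationalPlactic f t) (w : List Letter) :
    ∃ A B : List ℕ+, (w.map f).prod =
      (A.map (f ∘ Letter.pos)).prod * (B.map (f ∘ Letter.dual)).prod := by
  induction w with
  | nil => exact ⟨[], [], by simp⟩
  | cons a w ih =>
    obtain ⟨A, B, hw⟩ := ih
    cases a with
    | pos i => exact ⟨i :: A, B, by simp [hw, mul_assoc]⟩
    | dual j =>
      obtain ⟨A', j', hA'⟩ := h.exists_dual_mul_prod_pos A j
      exact ⟨A', j' :: B, by simp [hw, ← mul_assoc, hA']⟩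

theorem exists_prod_eq_prod_columnWord (h : IsRationalPlactic f t) (w : List Letter) :
    ∃ Cs Ds : List (List ℕ+), IsColumnList Cs ∧ IsColumnList Ds ∧ (w.map f).prod =
      ((columnWord Cs).map (f ∘ Letter.pos)).prod *
        ((columnWord Ds).reverse.map (f ∘ Letter.dual)).prod := by
  obtain ⟨A, B, hw⟩ := h.exists_prod_eq_prod_pos_mul_prod_dual w
  have hA := h.isPlactic_pos.prod_columnWord_insertionTableau A
  have hB := congrArg MulOpposite.unop
    (h.isPlactic_op_dual.prod_columnWord_insertionTableau B.reverse)
  simp only [MulOpposite.unop_list_prod, ← List.map_reverse, List.map_map, List.reverse_reverse,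
    ← Function.comp_assoc, MulOpposite.unop_comp_op, Function.id_comp] at hB
  exact ⟨insertionTableau A, insertionTableau B.reverse, isColumnList_insertionTableau A,
    isColumnList_insertionTableau B.reverse, by rw [hw, hA, hB]⟩

end IsRationalPlactic

section Contraction

/-- The element `a` is `t` times a word monomial. -/
def Contracts (f : Letter → M) (t a : M) : Prop :=
  ∃ w : List Letter, a = t * (w.map f).prod

/-- An intermediate stage of the straightening of `u_A u_{B^∨}`, for two columns `A` and `B`, at
which all letters `≥ n` have been dealt with: the product `u_{A'} (u_n u_{n^∨})^m u_{B'^∨}`, where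
`A'` and `B'` consist of the letters `< n` of `A` and of `B`. -/
def truncatedProd (f : Letter → M) (A B : List ℕ+) (n : ℕ+) (m : ℕ) : M :=
  ((A.filter (· < n)).map (f ∘ Letter.pos)).prod * (f (.pos n) * f (.dual n)) ^ m *
    ((B.filter (· < n)).reverse.map (f ∘ Letter.dual)).prod

theorem filter_le_of_notMem {α : Type*} [LinearOrder α] {n : α} {A : List α} (hn : n ∉ A) :
    A.filter (· ≤ n) = A.filter (· < n) := by
  refine List.filter_congr fun a ha => ?_
  have hne : a ≠ n := by rintro rfl; exact hn ha
  simp only [hne.le_iff_lt]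

theorem filter_le_of_mem {α : Type*} [LinearOrder α] {n : α} {A : List α}
    (hA : A.Pairwise (· < ·)) (hn : n ∈ A) :
    A.filter (· ≤ n) = A.filter (· < n) ++ [n] := by
  obtain ⟨L, R, rfl⟩ := List.append_of_mem hn
  obtain ⟨-, hR, hL⟩ := List.pairwise_append.1 hA
  have hL : ∀ a ∈ L, a < n := fun a ha => hL a ha n (by simp)
  have hR : ∀ a ∈ R, n < a := (List.pairwise_cons.1 hR).1
  have hL_le : L.filter (· ≤ n) = L :=
    List.filter_eq_self.2 (by simpa using fun a ha => (hL a ha).le)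
  have hL_lt : L.filter (· < n) = L :=
    List.filter_eq_self.2 (by simpa using hL)
  have hR_le : R.filter (· ≤ n) = [] :=
    List.filter_eq_nil_iff.2 (by simpa using hR)
  have hR_lt : R.filter (· < n) = [] :=
    List.filter_eq_nil_iff.2 (by simpa using fun a ha => (hR a ha).le)
  simp [hL_le, hL_lt, hR_le, hR_lt]

namespace Contracts

variable {f : Letter → M} {t a : M}

theorem mul_prod (ha : Contracts f t a) (w : List Letter) : Contracts f t (a * (w.map f).prod) := by
  obtain ⟨v, rfl⟩ := ha
  exact ⟨v ++ w, by simp [mul_assoc]⟩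

theorem prod_mul (h : IsRationalPlactic f t) (ha : Contracts f t a) (w : List Letter) :
    Contracts f t ((w.map f).prod * a) := by
  obtain ⟨v, rfl⟩ := ha
  have hw : Commute t (w.map f).prod :=
    Commute.list_prod_right _ _ (List.forall_mem_map.2 fun a _ => h.central a)
  exact ⟨w ++ v, by rw [List.map_append, List.prod_append, ← mul_assoc, ← hw.eq, mul_assoc]⟩

end Contracts

namespace IsRationalPlactic

variable {f : Letter → M} {t : M} {A B : List ℕ+}

theorem contracts_pow_succ (h : IsRationalPlactic f t) (m : ℕ) : Contracts f t (t ^ (m + 1)) := by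
  induction m with
  | zero => exact ⟨[], by simp⟩
  | succ m ih => simpa [pow_succ _ (m + 1), h.contract] using ih.mul_prod [.pos 1, .dual 1]

/-- The pairs `u_{n+1} u_{(n+1)^∨} = u_{n^∨} u_n` are regrouped into pairs `u_n u_{n^∨}`, which
absorb the letters `n` of `A` and of `B`. -/
theorem exists_truncatedProd_add_one (h : IsRationalPlactic f t) (hA : A.Pairwise (· < ·))
    (hB : B.Pairwise (· < ·)) (n : ℕ+) (m : ℕ) :
    ∃ (l r : List Letter) (m' : ℕ), truncatedProd f A B (n + 1) m =
        (l.map f).prod * truncatedProd f A B n m' * (r.map f).prod ∧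
      A.countP (· < n + 1) + B.countP (· < n + 1) + m ≤
        A.countP (· < n) + B.countP (· < n) + m' + 1 := by
  have hP := (h.commute_dual_prod_pos (n := n) (A := A.filter (· < n)) (by simp)).eq
  have hQ := (h.commute_pos_prod_dual (n := n) (B := (B.filter (· < n)).reverse) (by simp)).eq
  have hpow := mul_pow_mul (f (.pos n)) (f (.dual n))
  have hpow' := mul_pow_mul (f (.dual n)) (f (.pos n))
  simp only [truncatedProd, h.shift, PNat.lt_add_one_iff, List.countP_eq_length_filter]
  by_cases hnA : n ∈ A <;> by_cases hnB : n ∈ B <;>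
    simp only [hnA, hnB, not_false_eq_true, filter_le_of_mem hA, filter_le_of_mem hB,
      filter_le_of_notMem, List.map_append, List.prod_append, List.reverse_append,
      List.length_append, List.reverse_singleton, List.map_singleton, List.prod_singleton,
      List.length_singleton, Function.comp_apply]
  all_goals
    set x := f (.pos n) with hx
    set y := f (.dual n) with hy
    generalize ((A.filter (· < n)).map (f ∘ Letter.pos)).prod = P at *
    generalize ((B.filter (· < n)).reverse.map (f ∘ Letter.dual)).prod = Q at *
  · have regroup : P * x * (y * x) ^ m * (y * Q) = P * (x * y) ^ (m + 1) * Q := by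
      grind [pow_succ]
    exact ⟨[], [], m + 1, by simpa using regroup, by omega⟩
  · have regroup : P * x * (y * x) ^ m * Q = P * (x * y) ^ m * Q * x := by grind
    exact ⟨[], [.pos n], m, by simpa [← hx] using regroup, by omega⟩
  · have regroup : P * (y * x) ^ m * (y * Q) = y * (P * (x * y) ^ m * Q) := by grind
    exact ⟨[.dual n], [], m, by simpa [← hy] using regroup, by omega⟩
  · cases m with
    | zero => exact ⟨[], [], 0, by simp, by omega⟩
    | succ m =>
      have regroup : P * (y * x) ^ (m + 1) * Q = y * (P * (x * y) ^ m * Q) * x := by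
        rw [pow_succ]; grind
      exact ⟨[.dual n], [.pos n], m, by simpa [← hx, ← hy] using regroup, by omega⟩

theorem contracts_truncatedProd_of_le (h : IsRationalPlactic f t) (hA : A.Pairwise (· < ·))
    (hB : B.Pairwise (· < ·)) (n : ℕ+) (m : ℕ)
    (hn : n ≤ A.countP (· < n) + B.countP (· < n) + m) :
    Contracts f t (truncatedProd f A B n m) := by
  induction n using PNat.recOn generalizing m with
  | one =>
    cases m with
    | zero => simp at hn
    | succ m => simpa [truncatedProd, h.contract] using h.contracts_pow_succ m
  | succ n ih =>
    obtain ⟨l, r, m', heq, hle⟩ := h.exists_truncatedProd_add_one hA hB n m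
    rw [heq]
    exact ((ih m' (by rw [PNat.add_coe, PNat.one_coe] at hn; omega)).prod_mul h l).mul_prod r

theorem contracts_truncatedProd_mono (h : IsRationalPlactic f t) (hA : A.Pairwise (· < ·))
    (hB : B.Pairwise (· < ·)) {k n : ℕ+} (hkn : k ≤ n)
    (hk : ∀ m, Contracts f t (truncatedProd f A B k m)) (m : ℕ) :
    Contracts f t (truncatedProd f A B n m) := by
  induction n using PNat.recOn generalizing m with
  | one => exact le_antisymm one_le hkn ▸ hk m
  | succ n ih =>
    rcases hkn.eq_or_lt with rfl | hkn
    · exact hk m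
    · obtain ⟨l, r, m', heq, -⟩ := h.exists_truncatedProd_add_one hA hB n m
      rw [heq]
      exact ((ih (PNat.lt_add_one_iff.1 hkn) m').prod_mul h l).mul_prod r

theorem contracts_of_lt_countP (h : IsRationalPlactic f t) (hA : A.Pairwise (· < ·))
    (hB : B.Pairwise (· < ·)) {k : ℕ+} (hk : k < A.countP (· ≤ k) + B.countP (· ≤ k)) :
    Contracts f t ((A.map (f ∘ Letter.pos)).prod * (B.reverse.map (f ∘ Letter.dual)).prod) := by
  obtain ⟨N, hN⟩ := Finset.exists_le (insert k (A ++ B).toFinset)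
  have hkN : k ≤ N := hN k (by simp)
  have hAN : A.filter (· ≤ N) = A := List.filter_eq_self.2 fun a ha => by
    simpa only [decide_eq_true_eq] using hN a (by simp [ha])
  have hBN : B.filter (· ≤ N) = B := List.filter_eq_self.2 fun b hb => by
    simpa only [decide_eq_true_eq] using hN b (by simp [hb])
  have hcontr (m : ℕ) : Contracts f t (truncatedProd f A B (k + 1) m) :=
    h.contracts_truncatedProd_of_le hA hB _ m <| by
      simp only [PNat.lt_add_one_iff, PNat.add_coe, PNat.one_coe]
      omega
  simpa [truncatedProd, hAN, hBN] using
    h.contracts_truncatedProd_mono hA hB (n := N + 1) (by simpa using hkN) hcontr 0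

theorem exists_rationalTableau_or_contracts (h : IsRationalPlactic f t) (w : List Letter) :
    (∃ (μ ν : YoungDiagram) (P : RationalTableau μ ν), (w.map f).prod =
      ((colWord P.left).map f).prod * ((dualColWord P.dualRight).map f).prod) ∨
    Contracts f t (w.map f).prod := by
  obtain ⟨Cs, Ds, hCs, hDs, hw⟩ := h.exists_prod_eq_prod_columnWord w
  by_cases hbound : ∀ k : ℕ+,
      (Cs.headD []).countP (· ≤ k) + (Ds.headD []).countP (· ≤ k) ≤ (k : ℕ)
  · refine Or.inl ⟨hCs.shape, hDs.shape, ⟨hCs.tableau, hDs.tableau, fun k => ?_⟩, ?_⟩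
    · simpa only [IsColumnList.card_filter_entry_tableau] using hbound k
    · simpa only [IsColumnList.colWord_tableau, IsColumnList.dualColWord_tableau, List.map_map]
        using hw
  · right
    push Not at hbound
    obtain ⟨k, hk⟩ := hbound
    have hcontr := h.contracts_of_lt_countP hCs.pairwise_lt_headD hDs.pairwise_lt_headD hk
    rw [hw, columnWord_eq_append_headD Cs, columnWord_eq_append_headD Ds]
    simpa only [List.map_append, List.prod_append, List.reverse_append, List.map_map, mul_assoc]
      using
      (hcontr.prod_mul h ((columnWord Cs.tail).map .pos)).mul_prod
        ((columnWord Ds.tail).reverse.map .dual)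

/-- All relations are homogeneous once `t` has degree `2`, so the degree can be adjoined to `M`. -/
theorem prodMk_degree (h : IsRationalPlactic f t) :
    IsRationalPlactic (M := M × Multiplicative ℕ) (fun a => (f a, .ofAdd 1)) (t, .ofAdd 2) where
  isPlactic_pos :=
    ⟨fun i j k hji hik => Prod.ext (h.isPlactic_pos.knuth₁ i j k hji hik) rfl,
      fun i j k hji hik => Prod.ext (h.isPlactic_pos.knuth₂ i j k hji hik) rfl⟩
  isPlactic_op_dual :=
    ⟨fun i j k hji hik => MulOpposite.unop_injective <| Prod.ext
        (congrArg MulOpposite.unop (h.isPlactic_op_dual.knuth₁ i j k hji hik)) rfl,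
      fun i j k hji hik => MulOpposite.unop_injective <| Prod.ext
        (congrArg MulOpposite.unop (h.isPlactic_op_dual.knuth₂ i j k hji hik)) rfl⟩
  shift i := Prod.ext (h.shift i) rfl
  contract := Prod.ext h.contract rfl
  commute i j hij := Prod.ext (h.commute i j hij).eq rfl
  central a := Prod.ext (h.central a).eq rfl

end IsRationalPlactic

end Contraction

theorem prod_map_prodMk_degree (f : Letter → M) (w : List Letter) :
    (w.map fun a => (f a, Multiplicative.ofAdd 1)).prod =
      ((w.map f).prod, Multiplicative.ofAdd w.length) := by
  induction w with
  | nil => rfl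
  | cons a w ih => simp [ih, ← ofAdd_add, add_comm]

end RationalPlactic

section PlacticAlgebra

theorem isRationalPlactic_u :
    IsRationalPlactic u (algebraMap Ground PlacticAlgebra (LaurentPolynomial.T 1)) := by
  have rel {x y} (hxy : PlacticRel x y) := RingQuot.mkAlgHom_rel Ground hxy
  have hpos (i) : RingQuot.mkAlgHom Ground PlacticRel (gen i) = u (.pos i) := rfl
  have hdual (i) : RingQuot.mkAlgHom Ground PlacticRel (genDual i) = u (.dual i) := rfl
  refine ⟨⟨fun i j k hji hik => ?_, fun i j k hji hik => ?_⟩,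
    ⟨fun i j k hji hik => MulOpposite.unop_injective ?_,
      fun i j k hji hik => MulOpposite.unop_injective ?_⟩,
    fun i => ?_, ?_, fun i j hij => ?_, fun a => Algebra.commutes _ _⟩
  · simpa only [map_mul, hpos, Function.comp_apply] using rel (.knuth₁ i j k hji hik)
  · simpa only [map_mul, hpos, Function.comp_apply] using rel (.knuth₂ i j k hji hik)
  · simpa only [map_mul, hdual, Function.comp_apply, MulOpposite.unop_mul, MulOpposite.unop_op,
      mul_assoc] using rel (.dualKnuth₁ i j k hji hik)
  · simpa only [map_mul, hdual, Function.comp_apply, MulOpposite.unop_mul, MulOpposite.unop_op,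
      mul_assoc] using rel (.dualKnuth₂ i j k hji hik)
  · simpa only [map_mul, hpos, hdual] using rel (.shift i)
  · simpa only [map_mul, hpos, hdual, AlgHom.commutes] using rel .contract
  · simpa only [map_mul, hpos, hdual, commute_iff_eq] using rel (.comm i j hij)

theorem algebraMap_T_one_pow_mul (ε : ℕ) (x : PlacticAlgebra) :
    algebraMap Ground PlacticAlgebra (LaurentPolynomial.T 1) ^ ε * x =
      (LaurentPolynomial.T (ε : ℤ) : Ground) • x := by
  rw [← map_pow, ← Algebra.smul_def, LaurentPolynomial.T_pow, mul_one]

end PlacticAlgebra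

end RationalPlactic

theorem mainTheorem6_general {M : Type*} [Monoid M] {f : RationalPlactic.Letter → M} {t : M}
    (h : RationalPlactic.IsRationalPlactic f t) (w : List RationalPlactic.Letter) :
    ∃ (μ ν : YoungDiagram) (P : RationalPlactic.RationalTableau μ ν) (ε : ℕ),
      w.length = μ.card + ν.card + 2 * ε ∧
      (w.map f).prod = t ^ ε * (((RationalPlactic.colWord P.left).map f).prod *
        ((RationalPlactic.dualColWord P.dualRight).map f).prod) := by
  induction hr : w.length using Nat.strong_induction_on generalizing w with
  | _ r ih =>
    subst hr
    rcases h.prodMk_degree.exists_rationalTableau_or_contracts w with ⟨μ, ν, P, hP⟩ | ⟨v, hv⟩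
    · simp only [RationalPlactic.prod_map_prodMk_degree, Prod.mk_mul_mk, Prod.mk.injEq,
        ← ofAdd_add, Multiplicative.ofAdd.injective.eq_iff, RationalPlactic.length_colWord,
        RationalPlactic.length_dualColWord] at hP
      exact ⟨μ, ν, P, 0, by omega, by simpa using hP.1⟩
    · simp only [RationalPlactic.prod_map_prodMk_degree, Prod.mk_mul_mk, Prod.mk.injEq,
        ← ofAdd_add, Multiplicative.ofAdd.injective.eq_iff] at hv
      obtain ⟨μ, ν, P, ε, hlen, hP⟩ := ih v.length (by omega) v rfl
      exact ⟨μ, ν, P, ε + 1, by omega, by rw [hv.1, hP, pow_succ', mul_assoc]⟩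

theorem mainTheorem6 (w : List RationalPlactic.Letter) :
    ∃ (μ ν : YoungDiagram) (P : RationalPlactic.RationalTableau μ ν) (ε : ℕ),
      w.length = μ.card + ν.card + 2 * ε ∧
      RationalPlactic.uWord w =
        (LaurentPolynomial.T (ε : ℤ) : RationalPlactic.Ground) • RationalPlactic.uTableau P := by
  obtain ⟨μ, ν, P, ε, hlen, hw⟩ :=
    mainTheorem6_general RationalPlactic.isRationalPlactic_u w
  exact ⟨μ, ν, P, ε, hlen, hw.trans (RationalPlactic.algebraMap_T_one_pow_mul ε _)⟩
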